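/- Let $K$ be an algebraically closed field. For a $K$-linear map $\Psi:\bigwedge^s K^n\to F$ with $s\ge 2$ and $F$ a $K$-vector space, the nullity $null(\Psi)$ is the maximum of the dimensions of subspaces $W\subseteq K^n$ such that $\Psi(w_1\wedge w_2\wedge v_3\wedge\dots\wedge v_s)=0$ for all $w_1,w_2\in W$ and $v_3,\dots,v_s\in K^n$. Let $n,m\ge 0$ be integers. (1) If $m\le 2n-4$, then every linear map $\Phi:\bigwedge^2K^n\to K^m$ has nullity at least $2$. (2) If $n\ge 1$ and $m>2n-4$, then there exists a linear map $\Phi:\bigwedge^2K^n\to K^m$ with nullity equal to $1$. (3) If $n\ge 4$, then every linear map $\Psi:\bigwedge^3K^n\to K$ has nullity at least $2$. -/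

import Mathlib

/-- The `k`-nullity of a skew-symmetric form `Ψ : ⋀ˢ Kⁿ → F` (used for `1 ≤ k ≤ s`): the maximal
dimension of a subspace `W ⊆ Kⁿ` such that `Ψ(W, …, W, Kⁿ, …, Kⁿ) = 0`, where `W` occupies the
first `k` of the `s` arguments. -/
noncomputable def kNullity {K : Type*} [Field K] {n s : ℕ} {F : Type*} [AddCommGroup F]
    [Module K F] (k : ℕ) (Ψ : (⋀[K]^s (Fin n → K)) →ₗ[K] F) : ℕ :=
  sSup {d : ℕ | ∃ W : Submodule K (Fin n → K), Module.finrank K W = d ∧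
    ∀ v : Fin s → (Fin n → K), (∀ i : Fin s, (i : ℕ) < k → v i ∈ W) →
      Ψ (exteriorPower.ιMulti K s v) = 0}

/-- The nullity of a skew-symmetric form is its `2`-nullity. -/
noncomputable def nullity {K : Type*} [Field K] {n s : ℕ} {F : Type*} [AddCommGroup F]
    [Module K F] (Ψ : (⋀[K]^s (Fin n → K)) →ₗ[K] F) : ℕ :=
  kNullity 2 Ψ

/-- The supremum in the definition of the `k`-nullity is an attained maximum. -/
theorem kNullity_isGreatest {K : Type*} [Field K] {n s : ℕ} {F : Type*} [AddCommGroup F]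
    [Module K F] (k : ℕ) (hk : 1 ≤ k) (hks : k ≤ s) (Ψ : (⋀[K]^s (Fin n → K)) →ₗ[K] F) :
    IsGreatest {d : ℕ | ∃ W : Submodule K (Fin n → K), Module.finrank K W = d ∧
      ∀ v : Fin s → (Fin n → K), (∀ i : Fin s, (i : ℕ) < k → v i ∈ W) →
        Ψ (exteriorPower.ιMulti K s v) = 0} (kNullity k Ψ) := by
  have hb : BddAbove {d : ℕ | ∃ W : Submodule K (Fin n → K), Module.finrank K W = d ∧
      ∀ v : Fin s → (Fin n → K), (∀ i : Fin s, (i : ℕ) < k → v i ∈ W) →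
        Ψ (exteriorPower.ιMulti K s v) = 0} := by
    refine ⟨n, ?_⟩
    rintro d ⟨W, rfl, -⟩
    simpa using W.finrank_le
  refine ⟨Nat.sSup_mem ⟨0, ⊥, by simp, ?_⟩ hb, fun d hd => le_csSup hb hd⟩
  intro v hv
  have h0 : v ⟨0, by omega⟩ = 0 := by
    simpa using hv ⟨0, by omega⟩ (by simp; omega)
  rw [(exteriorPower.ιMulti K s).map_coord_zero _ h0, map_zero]

/-!
Write `Ψ(x ∧ y ∧ u)` as an alternating bilinear map with values in the space of alternating
`(s - 2)`-forms; the nullity is at least two exactly when this map kills some linearly independent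
pair. That is a system of linear equations in the Plücker coordinates of the pair. The cone over the
Grassmannian `G(2, n)` has dimension `2 n - 3`, so over an algebraically closed field at most
`2 n - 4` equations leave a nonzero solution.

The dimension argument is a specialization: if `p` is a generic point of a cone and there are fewer
homogeneous equations `fₖ` than the dimension of the cone, then the coordinates of `p` cannot all be
integral over `K[fₖ(p)]`. So some valuation ring contains every `fₖ(p)` but misses a coordinate of
`p`, and reducing `p` divided by its largest coordinate gives a nonzero point on the cone at which
every `fₖ` vanishes.

Conversely, summing the Plücker coordinates along the antidiagonals of `{(i, j) | i < j}` gives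
`2 n - 3` linear forms without a common zero on the cone, because on an antidiagonal whose
predecessors vanish the Plücker relations allow only one nonzero coordinate.
-/

section Specialization

open MvPolynomial

theorem exists_valuationSubring_notMem_of_not_isIntegral {R F : Type*} [CommRing R] [Field F]
    [Algebra R F] {z : F} (hz : ¬ IsIntegral R z) :
    ∃ V : ValuationSubring F, (∀ r, algebraMap R F r ∈ V) ∧ z ∉ V := by
  by_contra! h
  have hmem : z ∈ (⨅ V : {V : ValuationSubring F //
      ((algebraMap R F).range : Set F) ⊆ V.toSubring}, V.1.toSubring) :=
    Subring.mem_iInf.2 fun V => h V.1 fun r => V.2 ⟨r, rfl⟩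
  rw [iInf_valuationSubring_superset, Subring.closure_eq] at hmem
  obtain ⟨f, hf, hfz⟩ : IsIntegral (algebraMap R F).range z := hmem
  obtain ⟨g, hgf, -, hg⟩ := Polynomial.lifts_and_degree_eq_and_monic
    ((Polynomial.mem_lifts _).2 (Polynomial.map_surjective _
      (algebraMap R F).rangeRestrict_surjective f)) hf
  refine hz ⟨g, hg, ?_⟩
  rwa [← hgf, Polynomial.eval₂_map] at hfz

theorem eval₂_div_of_isHomogeneous {R F ι : Type*} [CommSemiring R] [Field F] {φ : R →+* F}
    {f : MvPolynomial ι R} {d : ℕ} (hf : f.IsHomogeneous d) (p : ι → F) (c : F) :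
    eval₂ φ (fun i => p i / c) f = eval₂ φ p f / c ^ d := by
  simp only [eval₂_eq, Finset.sum_div]
  refine Finset.sum_congr rfl fun m hm => ?_
  have hdeg : ∑ i ∈ m.support, m i = d := by
    simpa [Finsupp.weight_apply, Finsupp.sum] using hf (mem_support_iff.1 hm)
  simp only [div_pow, Finset.prod_div_distrib, Finset.prod_pow_eq_pow_sum, hdeg, mul_div_assoc]

variable {K ι : Type*} [Field K] [IsAlgClosed K] [Finite ι]

theorem exists_eval_eq_zero_of_eval₂_eq_zero {Ω : Type*} [CommRing Ω] [Nontrivial Ω]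
    (φ : K →+* Ω) (z : ι → Ω) :
    ∃ w : ι → K, ∀ f : MvPolynomial ι K, eval₂ φ z f = 0 → eval w f = 0 := by
  obtain ⟨M, hM, hle⟩ := Ideal.exists_le_maximal _ (RingHom.ker_ne_top (eval₂Hom φ z))
  obtain ⟨w, rfl⟩ := isMaximal_iff_eq_vanishingIdeal_singleton.1 hM
  exact ⟨w, fun f hf => (mem_vanishingIdeal_singleton_iff w f).1 (hle hf)⟩

theorem exists_forall_isHomogeneous_eval_eq_zero_of_valuationSubring {F : Type*} [Field F]
    [Algebra K F] {V : ValuationSubring F} (hK : ∀ r, algebraMap K F r ∈ V)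
    {p : ι → F} {i : ι} (hi : p i ∉ V) :
    ∃ w : ι → K, w ≠ 0 ∧ ∀ (f : MvPolynomial ι K) (d : ℕ), d ≠ 0 → f.IsHomogeneous d →
      aeval p f ∈ V → eval w f = 0 := by
  have : Nonempty ι := ⟨i⟩
  obtain ⟨a, hmax⟩ := Finite.exists_max fun j => V.valuation (p j)
  have ha : 1 < V.valuation (p a) :=
    (not_le.1 fun h => hi ((V.valuation_le_one_iff _).1 h)).trans_le (hmax i)
  have ha0 : p a ≠ 0 := fun h => by simp [h] at ha
  let φ : K →+* V := (algebraMap K F).codRestrict V hK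
  let q : ι → V := fun j => ⟨p j / p a, by
    rw [← V.valuation_le_one_iff, map_div₀]
    exact div_le_one_of_le₀ (hmax j) zero_le⟩
  obtain ⟨w, hw⟩ := exists_eval_eq_zero_of_eval₂_eq_zero
    ((IsLocalRing.residue V).comp φ) (IsLocalRing.residue V ∘ q)
  refine ⟨w, fun h0 => ?_, fun f d hd hf hfp => hw f ?_⟩
  · have hqa : q a = 1 := Subtype.ext (div_self ha0)
    have := hw (X a - 1) (by simp [hqa])
    simp [h0] at this
  · have hval : ((eval₂ φ q f : V) : F) = aeval p f / p a ^ d := by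
      rw [← V.subtype_apply, hom_eval₂]
      exact eval₂_div_of_isHomogeneous hf p (p a)
    rw [Function.comp_def, ← hom_eval₂, IsLocalRing.residue_eq_zero_iff, V.valuation_lt_one_iff,
      hval, map_div₀, map_pow]
    have hlt : 1 < V.valuation (p a) ^ d := one_lt_pow₀ ha hd
    exact (div_lt_one₀ (zero_lt_one.trans hlt)).2
      (((V.valuation_le_one_iff _).2 hfp).trans_lt hlt)

theorem exists_forall_isHomogeneous_eval_eq_zero_of_not_isIntegral {A : Type*} [CommRing A]
    [IsDomain A] [Algebra K A] {R : Subalgebra K A} {p : ι → A} {i : ι}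
    (hi : ¬ IsIntegral R (p i)) :
    ∃ w : ι → K, w ≠ 0 ∧ ∀ (f : MvPolynomial ι K) (d : ℕ), d ≠ 0 → f.IsHomogeneous d →
      aeval p f ∈ R → eval w f = 0 := by
  let F := FractionRing A
  have hi' : ¬ IsIntegral R (algebraMap A F (p i)) :=
    mt (isIntegral_algebraMap_iff (IsFractionRing.injective A F)).1 hi
  obtain ⟨V, hRV, hiV⟩ := exists_valuationSubring_notMem_of_not_isIntegral hi'
  obtain ⟨w, hw, h⟩ := exists_forall_isHomogeneous_eval_eq_zero_of_valuationSubring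
    (p := algebraMap A F ∘ p) (fun r => hRV (algebraMap K R r)) hiV
  refine ⟨w, hw, fun f d hd hf hfR => h f d hd hf ?_⟩
  rw [aeval_algebraMap_apply]
  exact hRV ⟨_, hfR⟩

/-- The cone parametrised by `p` is cut out by the forms `g` with `g(p) = 0`, and the transcendence
degree of `A` is its dimension. -/
theorem exists_common_zero_of_card_lt_trdeg {A κ : Type*} [CommRing A] [IsDomain A]
    [Algebra K A] [Fintype κ] {p : ι → A}
    (hp : Algebra.IsAlgebraic (Algebra.adjoin K (Set.range p)) A)
    (hκ : (Fintype.card κ : Cardinal) < Algebra.trdeg K A) {f : κ → MvPolynomial ι K} {d : κ → ℕ}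
    (hd : ∀ k, d k ≠ 0) (hf : ∀ k, (f k).IsHomogeneous (d k)) :
    ∃ w : ι → K, w ≠ 0 ∧ (∀ k, eval w (f k) = 0) ∧
      ∀ (g : MvPolynomial ι K) (e : ℕ), e ≠ 0 → g.IsHomogeneous e → aeval p g = 0 →
        eval w g = 0 := by
  set t : Set A := Set.range fun k => aeval p (f k)
  obtain ⟨i, hi⟩ : ∃ i, ¬ IsIntegral (Algebra.adjoin K t) (p i) := by
    by_contra! h
    have : Algebra.IsAlgebraic (Algebra.adjoin K t) A := ⟨fun a =>
      (hp.isAlgebraic a).adjoin_of_forall_isAlgebraic <| by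
        rintro _ ⟨⟨i, rfl⟩, -⟩
        exact (h i).isAlgebraic⟩
    have ht : Cardinal.mk t ≤ Fintype.card κ := by
      simpa using Cardinal.mk_range_le_lift (f := fun k => aeval p (f k))
    exact hκ.not_ge ((Algebra.IsAlgebraic.trdeg_le_cardinalMk K t).trans ht)
  obtain ⟨w, hw, h⟩ := exists_forall_isHomogeneous_eval_eq_zero_of_not_isIntegral hi
  exact ⟨w, hw, fun k => h _ _ (hd k) (hf k) (Algebra.subset_adjoin ⟨k, rfl⟩),
    fun g e he hg hg0 => h g e he hg (hg0 ▸ zero_mem _)⟩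

end Specialization

section PluckerCoordinates

/-- The Plücker coordinates of the pair `(x, y)`, that is, the `2 × 2` minors of the matrix with
rows `x` and `y`. They are indexed by all pairs of indices rather than the increasing ones, so that
the quadratic relations need no order on `ι` and include antisymmetry. -/
def pluckerCoord {R ι : Type*} [CommRing R] (x y : ι → R) (q : ι × ι) : R :=
  x q.1 * y q.2 - x q.2 * y q.1

theorem pluckerCoord_self {R ι : Type*} [CommRing R] (x y : ι → R) (i : ι) :
    pluckerCoord x y (i, i) = 0 := by
  simp [pluckerCoord]

theorem pluckerCoord_swap {R ι : Type*} [CommRing R] (x y : ι → R) (i j : ι) :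
    pluckerCoord x y (j, i) = -pluckerCoord x y (i, j) := by
  simp [pluckerCoord]

theorem pluckerCoord_mul_pluckerCoord {R ι : Type*} [CommRing R] (x y : ι → R) (a b c d : ι) :
    pluckerCoord x y (a, b) * pluckerCoord x y (c, d) =
      pluckerCoord x y (a, c) * pluckerCoord x y (b, d) -
        pluckerCoord x y (a, d) * pluckerCoord x y (b, c) := by
  simp only [pluckerCoord]
  ring

theorem linearIndependent_pair_iff_exists_pluckerCoord_ne_zero {R ι : Type*} [CommRing R]
    [IsDomain R] {x y : ι → R} : LinearIndependent R ![x, y] ↔ ∃ q, pluckerCoord x y q ≠ 0 := by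
  rw [LinearIndependent.pair_iff]
  constructor
  · intro h
    by_contra! hq
    have hdep (i : ι) : y i • x + -x i • y = 0 := funext fun j => by
      have hij : x i * y j - x j * y i = 0 := hq (i, j)
      simp only [Pi.add_apply, Pi.smul_apply, smul_eq_mul, Pi.zero_apply]
      linear_combination -hij
    have hy : y = 0 := funext fun i => (h _ _ (hdep i)).1
    exact one_ne_zero (h 0 1 (by simp [hy])).2
  · rintro ⟨⟨i, j⟩, hq⟩ s t h
    have hi := congrFun h i
    have hj := congrFun h j
    simp only [Pi.add_apply, Pi.smul_apply, smul_eq_mul, Pi.zero_apply] at hi hj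
    constructor
    · refine (mul_eq_zero.1 ?_).resolve_right hq
      simp only [pluckerCoord]
      linear_combination y j * hi - y i * hj
    · refine (mul_eq_zero.1 ?_).resolve_right hq
      simp only [pluckerCoord]
      linear_combination x i * hj - x j * hi

theorem apply_eq_sum_pluckerCoord_smul_of_isAlt {R N ι : Type*} [CommRing R] [AddCommGroup N]
    [Module R N] [Fintype ι] [LinearOrder ι] [LocallyFiniteOrderTop ι] [LocallyFiniteOrderBot ι]
    {B : (ι → R) →ₗ[R] (ι → R) →ₗ[R] N} (hB : B.IsAlt) (x y : ι → R) :
    B x y = ∑ i, ∑ j ∈ Finset.Ioi i,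
      pluckerCoord x y (i, j) • B (Pi.single i 1) (Pi.single j 1) := by
  let e := Pi.basisFun R ι
  have hxy : B x y = ∑ i, ∑ j, (x j * y i) • B (e j) (e i) := by
    conv_lhs => rw [← e.sum_repr x, ← e.sum_repr y]
    simp only [map_sum, LinearMap.sum_apply, map_smul, LinearMap.smul_apply, e,
      Pi.basisFun_repr, Finset.smul_sum, smul_smul, mul_comm]
  have hdiag (i : ι) : ∑ j, (x j * y i) • B (e j) (e i) =
      ∑ j ∈ {i}ᶜ, (x j * y i) • B (e j) (e i) := by
    rw [← Finset.sum_compl_add_sum {i}, Finset.sum_singleton, hB, smul_zero, add_zero]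
  rw [hxy, Finset.sum_congr rfl fun i _ => hdiag i,
    ← Finset.sum_sum_Ioi_add_eq_sum_sum_off_diag]
  refine Finset.sum_congr rfl fun i _ => Finset.sum_congr rfl fun j _ => ?_
  rw [← hB.neg (e i) (e j)]
  simp only [e, Pi.basisFun_apply, pluckerCoord]
  module

end PluckerCoordinates

section PairForm

variable {R M N : Type*} [CommRing R] [AddCommGroup M] [Module R M] [AddCommGroup N] [Module R N]
  {s : ℕ}

/-- The bilinear map `(x, y) ↦ (u ↦ Ψ (x ∧ y ∧ u))` attached to a linear map `Ψ` on an exterior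
power, through which the nullity of `Ψ` becomes a question about isotropic subspaces. -/
noncomputable def pairForm (Ψ : ⋀[R]^(s + 2) M →ₗ[R] N) : M →ₗ[R] M →ₗ[R] M [⋀^Fin s]→ₗ[R] N :=
  AlternatingMap.curryLeftLinearMap ∘ₗ
    (Ψ.compAlternatingMap (exteriorPower.ιMulti R (s + 2))).curryLeft

theorem pairForm_apply (Ψ : ⋀[R]^(s + 2) M →ₗ[R] N) (x y : M) (u : Fin s → M) :
    pairForm Ψ x y u =
      Ψ (exteriorPower.ιMulti R (s + 2) (Matrix.vecCons x (Matrix.vecCons y u))) :=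
  rfl

theorem isAlt_pairForm (Ψ : ⋀[R]^(s + 2) M →ₗ[R] N) : (pairForm Ψ).IsAlt :=
  AlternatingMap.curryLeft_same _

theorem forall_map_ιMulti_eq_zero_iff (Ψ : ⋀[R]^(s + 2) M →ₗ[R] N) (W : Submodule R M) :
    (∀ v : Fin (s + 2) → M, (∀ i : Fin (s + 2), (i : ℕ) < 2 → v i ∈ W) →
      Ψ (exteriorPower.ιMulti R (s + 2) v) = 0) ↔ ∀ x ∈ W, ∀ y ∈ W, pairForm Ψ x y = 0 := by
  constructor
  · intro h x hx y hy
    ext u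
    rw [pairForm_apply]
    refine h _ fun i => ?_
    refine Fin.cases (fun _ => hx) (fun i => ?_) i
    refine Fin.cases (fun _ => hy) (fun i hi => ?_) i
    simp at hi
  · intro h v hv
    have hvec : v = Matrix.vecCons (v 0)
        (Matrix.vecCons (v 1) (Matrix.vecTail (Matrix.vecTail v))) := by
      rw [show v 1 = Matrix.vecHead (Matrix.vecTail v) from rfl, Matrix.cons_head_tail]
      exact (Matrix.cons_head_tail v).symm
    rw [hvec, ← pairForm_apply, h _ (hv 0 (by simp)) _ (hv 1 (by simp)), AlternatingMap.zero_apply]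

theorem apply_eq_zero_of_isAlt_of_mem_span_pair {B : M →ₗ[R] M →ₗ[R] N} (hB : B.IsAlt)
    {x y x' y' : M} (h : B x y = 0) (hx' : x' ∈ Submodule.span R {x, y})
    (hy' : y' ∈ Submodule.span R {x, y}) : B x' y' = 0 := by
  obtain ⟨a, b, rfl⟩ := Submodule.mem_span_pair.1 hx'
  obtain ⟨c, d, rfl⟩ := Submodule.mem_span_pair.1 hy'
  simp [hB x, hB y, h, hB.eq_iff.1 h]

end PairForm

section Nullity

variable {K F : Type*} [Field K] [AddCommGroup F] [Module K F] {n s : ℕ}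
  {Ψ : ⋀[K]^(s + 2) (Fin n → K) →ₗ[K] F}

theorem le_nullity_iff {d : ℕ} :
    d ≤ nullity Ψ ↔ ∃ W : Submodule K (Fin n → K), d ≤ Module.finrank K W ∧
      ∀ x ∈ W, ∀ y ∈ W, pairForm Ψ x y = 0 := by
  simp only [← forall_map_ιMulti_eq_zero_iff]
  have hmax := kNullity_isGreatest 2 one_le_two (Nat.le_add_left 2 s) Ψ
  constructor
  · intro hd
    obtain ⟨W, hW, h⟩ := hmax.1
    exact ⟨W, hd.trans hW.ge, h⟩
  · rintro ⟨W, hd, h⟩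
    exact hd.trans (hmax.2 ⟨W, rfl, h⟩)

theorem one_le_nullity (hn : 1 ≤ n) : 1 ≤ nullity Ψ := by
  let e : Fin n → K := Pi.single ⟨0, hn⟩ 1
  refine le_nullity_iff.2 ⟨Submodule.span K {e}, (finrank_span_singleton (by simp [e])).ge, ?_⟩
  intro x hx y hy
  rw [← Set.pair_eq_singleton] at hx hy
  exact apply_eq_zero_of_isAlt_of_mem_span_pair (isAlt_pairForm Ψ) (isAlt_pairForm Ψ e) hx hy

theorem two_le_nullity_iff :
    2 ≤ nullity Ψ ↔ ∃ x y, LinearIndependent K ![x, y] ∧ pairForm Ψ x y = 0 := by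
  rw [le_nullity_iff]
  constructor
  · rintro ⟨W, hW, h⟩
    obtain ⟨v, hv⟩ := exists_linearIndependent_of_le_finrank hW
    refine ⟨v 0, v 1, ?_, h _ (v 0).2 _ (v 1).2⟩
    have hvec : ![(v 0 : Fin n → K), v 1] = W.subtype ∘ v := by
      ext i : 1
      fin_cases i <;> rfl
    exact hvec ▸ hv.map' W.subtype W.ker_subtype
  · rintro ⟨x, y, hxy, h⟩
    refine ⟨Submodule.span K {x, y}, ?_, fun x' hx' y' hy' =>
      apply_eq_zero_of_isAlt_of_mem_span_pair (isAlt_pairForm Ψ) h hx' hy'⟩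
    have hrange : Set.range ![x, y] = {x, y} := by
      rw [Matrix.range_cons, Matrix.range_cons, Matrix.range_empty, Set.union_empty,
        Set.singleton_union]
    exact hrange ▸ (finrank_span_eq_card hxy).ge

end Nullity

section Grassmannian

open MvPolynomial

theorem exists_isAlgebraic_adjoin_range_pluckerCoord (R : Type*) [CommRing R]
    [IsDomain R] (r : ℕ) :
    ∃ x y : Fin (r + 2) → MvPolynomial (Option (Fin r ⊕ Fin r)) R,
      Algebra.IsAlgebraic (Algebra.adjoin R (Set.range (pluckerCoord x y)))
        (MvPolynomial (Option (Fin r ⊕ Fin r)) R) := by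
  -- The minors of `x = (t, 0, a)` and `y = (0, 1, b)` include `t`, `aᵢ` and `t bᵢ`.
  let A := MvPolynomial (Option (Fin r ⊕ Fin r)) R
  let x : Fin (r + 2) → A := Matrix.vecCons (X none) (Matrix.vecCons 0 fun i => X (some (.inl i)))
  let y : Fin (r + 2) → A := Matrix.vecCons 0 (Matrix.vecCons 1 fun i => X (some (.inr i)))
  refine ⟨x, y, ⟨fun a => ?_⟩⟩
  set S := Algebra.adjoin R (Set.range (pluckerCoord x y))
  have hp (q) : IsAlgebraic S (pluckerCoord x y q) :=
    isAlgebraic_algebraMap (⟨_, Algebra.subset_adjoin ⟨q, rfl⟩⟩ : S)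
  have hnone : IsAlgebraic S (X none : A) := by
    simpa [pluckerCoord, x, y] using hp (0, 1)
  have hX (i) : IsAlgebraic S (X i : A) := by
    rcases i with _ | i | i
    · exact hnone
    · simpa [pluckerCoord, x, y] using hp (i.succ.succ, 1)
    · refine .of_mul (mem_nonZeroDivisors_of_ne_zero (X_ne_zero none)) hnone ?_
      simpa [pluckerCoord, x, y, mul_comm] using hp (0, i.succ.succ)
  have ha : IsAlgebraic (Algebra.adjoin R (Set.range (X : _ → A))) a :=
    isAlgebraic_algebraMap (⟨a, adjoin_range_X (R := R) ▸ trivial⟩ : Algebra.adjoin R _)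
  refine ha.adjoin_of_forall_isAlgebraic ?_
  rintro _ ⟨⟨i, rfl⟩, -⟩
  exact hX i

variable {K : Type*} [Field K]

theorem exists_pluckerCoord_eq {ι : Type*} {w : ι × ι → K} (hw : w ≠ 0)
    (h : ∀ a b i j, w (a, b) * w (i, j) = w (a, i) * w (b, j) - w (a, j) * w (b, i)) :
    ∃ x y : ι → K, pluckerCoord x y = w := by
  obtain ⟨⟨a, b⟩, hab⟩ := Function.ne_iff.1 hw
  refine ⟨fun i => w (a, i) / w (a, b), fun j => w (b, j), funext fun ⟨i, j⟩ => ?_⟩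
  rw [pluckerCoord, div_mul_eq_mul_div, div_mul_eq_mul_div, ← sub_div, ← h,
    mul_div_cancel_left₀ _ hab]

theorem exists_linearIndependent_forall_eval_pluckerCoord_eq_zero [IsAlgClosed K] {n : ℕ}
    {κ : Type*} [Fintype κ] (hκ : Fintype.card κ + 4 ≤ 2 * n)
    {f : κ → MvPolynomial (Fin n × Fin n) K} {d : κ → ℕ} (hd : ∀ k, d k ≠ 0)
    (hf : ∀ k, (f k).IsHomogeneous (d k)) :
    ∃ x y, LinearIndependent K ![x, y] ∧ ∀ k, eval (pluckerCoord x y) (f k) = 0 := by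
  obtain ⟨r, rfl⟩ : ∃ r, n = r + 2 := ⟨n - 2, by omega⟩
  obtain ⟨x, y, hxy⟩ := exists_isAlgebraic_adjoin_range_pluckerCoord K r
  have htrdeg : (Fintype.card κ : Cardinal) <
      Algebra.trdeg K (MvPolynomial (Option (Fin r ⊕ Fin r)) K) := by
    simp only [trdeg_of_isDomain, Cardinal.mk_fintype, Fintype.card_option, Fintype.card_sum,
      Fintype.card_fin, Cardinal.lift_natCast]
    norm_cast
    omega
  obtain ⟨w, hw, hwf, hrel⟩ := exists_common_zero_of_card_lt_trdeg hxy htrdeg hd hf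
  obtain ⟨x', y', rfl⟩ := exists_pluckerCoord_eq hw fun a b i j => by
    have hX (q : Fin (r + 2) × Fin (r + 2)) := isHomogeneous_X K q
    have := hrel (X (a, b) * X (i, j) - (X (a, i) * X (b, j) - X (a, j) * X (b, i))) 2 two_ne_zero
      (((hX _).mul (hX _)).sub (((hX _).mul (hX _)).sub ((hX _).mul (hX _))))
      (by simp [pluckerCoord_mul_pluckerCoord x y a b i j])
    simpa [sub_eq_zero] using this
  exact ⟨x', y', linearIndependent_pair_iff_exists_pluckerCoord_ne_zero.2 (Function.ne_iff.1 hw),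
    hwf⟩

end Grassmannian

section IsotropicPair

open MvPolynomial

variable {K : Type*} [Field K] [IsAlgClosed K] {n : ℕ}

theorem exists_linearIndependent_apply_eq_zero_of_isAlt {N : Type*} [AddCommGroup N] [Module K N]
    [Module.Finite K N] (hn : Module.finrank K N + 4 ≤ 2 * n)
    {B : (Fin n → K) →ₗ[K] (Fin n → K) →ₗ[K] N} (hB : B.IsAlt) :
    ∃ x y, LinearIndependent K ![x, y] ∧ B x y = 0 := by
  let b := Module.finBasis K N
  let c (k) (q : Fin n × Fin n) : K := b.coord k (B (Pi.single q.1 1) (Pi.single q.2 1))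
  have hf (k) : (∑ i, ∑ j ∈ Finset.Ioi i, C (c k (i, j)) * X (i, j)).IsHomogeneous 1 :=
    .sum _ _ _ fun i _ => .sum _ _ _ fun j _ => isHomogeneous_C_mul_X _ _
  obtain ⟨x, y, hxy, h⟩ := exists_linearIndependent_forall_eval_pluckerCoord_eq_zero
    (by rwa [Fintype.card_fin]) (fun _ => one_ne_zero) hf
  refine ⟨x, y, hxy, b.forall_coord_eq_zero_iff.1 fun k => ?_⟩
  rw [apply_eq_sum_pluckerCoord_smul_of_isAlt hB]
  simpa only [map_sum, map_smul, smul_eq_mul, map_mul, eval_C, eval_X, mul_comm] using h k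

end IsotropicPair

section NullityBound

theorem finrank_alternatingMap {R M N : Type*} [CommRing R] [Nontrivial R] [AddCommGroup M]
    [Module R M] [Module.Free R M] [Module.Finite R M] [AddCommGroup N] [Module R N]
    [Module.Free R N] (s : ℕ) :
    Module.finrank R (M [⋀^Fin s]→ₗ[R] N) =
      (Module.finrank R M).choose s * Module.finrank R N := by
  rw [exteriorPower.alternatingMapLinearEquiv.finrank_eq, Module.finrank_linearMap,
    exteriorPower.finrank_eq]

theorem two_le_nullity {K F : Type*} [Field K] [IsAlgClosed K] [AddCommGroup F] [Module K F]
    [Module.Finite K F] {n s : ℕ} (hn : n.choose s * Module.finrank K F + 4 ≤ 2 * n)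
    (Ψ : ⋀[K]^(s + 2) (Fin n → K) →ₗ[K] F) : 2 ≤ nullity Ψ := by
  have : Module.Finite K ((Fin n → K) [⋀^Fin s]→ₗ[K] F) :=
    .equiv exteriorPower.alternatingMapLinearEquiv.symm
  refine two_le_nullity_iff.2
    (exists_linearIndependent_apply_eq_zero_of_isAlt ?_ (isAlt_pairForm Ψ))
  rwa [finrank_alternatingMap, Module.finrank_fin_fun]

end NullityBound

section AntidiagonalMap

variable {R : Type*} [CommRing R] {n m : ℕ} {x y : Fin n → R}

theorem pluckerCoord_mul_pluckerCoord_eq_zero_of_add_eq {i j c d : Fin n}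
    (hzero : ∀ a b : Fin n, (a + b : ℕ) < i + j → pluckerCoord x y (a, b) = 0) (hij : i < j)
    (hcd : c < d) (hsum : (c + d : ℕ) = i + j) (hne : (c, d) ≠ (i, j)) :
    pluckerCoord x y (i, j) * pluckerCoord x y (c, d) = 0 := by
  simp only [ne_eq, Prod.mk.injEq, Fin.ext_iff] at hne
  rw [Fin.lt_def] at hij hcd
  rw [pluckerCoord_mul_pluckerCoord, hzero i c (by omega)]
  obtain h | h : (i + d : ℕ) < i + j ∨ (j + c : ℕ) < i + j := by omega
  · rw [hzero i d h, zero_mul, zero_mul, sub_zero]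
  · rw [hzero j c h, zero_mul, mul_zero, sub_zero]

variable (R n m) in
/-- The linear map `⋀² Rⁿ → Rᵐ` whose `k`-th component is the sum of the Plücker coordinates
indexed by the pairs `i < j` on the antidiagonal `i + j = k + 1`. -/
noncomputable def antidiagonalMap : ⋀[R]^2 (Fin n → R) →ₗ[R] Fin m → R :=
  LinearMap.pi fun k => ∑ q : Fin n × Fin n with q.1 < q.2 ∧ (q.1 + q.2 : ℕ) = k + 1,
    exteriorPower.pairingDual R (Fin n → R) 2
      (exteriorPower.ιMulti R 2 ![LinearMap.proj q.1, LinearMap.proj q.2])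

theorem antidiagonalMap_ιMulti (k : Fin m) :
    antidiagonalMap R n m (exteriorPower.ιMulti R 2 ![x, y]) k =
      ∑ q : Fin n × Fin n with q.1 < q.2 ∧ (q.1 + q.2 : ℕ) = k + 1, pluckerCoord x y q := by
  simp [antidiagonalMap, Matrix.det_fin_two, pluckerCoord]

theorem exists_pluckerCoord_ne_zero_and_minimal_add [IsDomain R]
    (h : LinearIndependent R ![x, y]) :
    ∃ i j : Fin n, i < j ∧ pluckerCoord x y (i, j) ≠ 0 ∧
      ∀ a b : Fin n, (a + b : ℕ) < i + j → pluckerCoord x y (a, b) = 0 := by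
  obtain ⟨⟨i, j⟩, hne, hmin⟩ := exists_minimalFor_of_wellFoundedLT _
    (fun q : Fin n × Fin n => (q.1 + q.2 : ℕ))
    (linearIndependent_pair_iff_exists_pluckerCoord_ne_zero.1 h)
  have hzero (a b : Fin n) (hab : (a + b : ℕ) < i + j) : pluckerCoord x y (a, b) = 0 :=
    by_contra fun h => hab.not_ge (hmin h hab.le)
  rcases lt_trichotomy i j with hij | rfl | hji
  · exact ⟨i, j, hij, hne, hzero⟩
  · exact absurd (pluckerCoord_self x y i) hne
  · refine ⟨j, i, hji, ?_, fun a b hab => hzero a b (by rwa [add_comm (i : ℕ)])⟩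
    rwa [pluckerCoord_swap, neg_ne_zero]

theorem antidiagonalMap_ιMulti_ne_zero [IsDomain R] (hm : 2 * n ≤ m + 3)
    (h : LinearIndependent R ![x, y]) :
    antidiagonalMap R n m (exteriorPower.ιMulti R 2 ![x, y]) ≠ 0 := by
  obtain ⟨i, j, hij, hne, hmin⟩ := exists_pluckerCoord_ne_zero_and_minimal_add h
  have hk : (i + j - 1 : ℕ) < m := by omega
  refine Function.ne_iff.2 ⟨⟨i + j - 1, hk⟩, ?_⟩
  rw [antidiagonalMap_ιMulti, Finset.sum_eq_single_of_mem (i, j)]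
  · exact hne
  · simpa [hij] using by omega
  · rintro ⟨c, d⟩ hcd hcdij
    obtain ⟨hlt, hsum⟩ := (Finset.mem_filter.1 hcd).2
    have hsum' : (c + d : ℕ) = i + j := by
      rw [Fin.lt_def] at hij
      exact hsum.trans (by lia)
    exact (mul_eq_zero.1 (pluckerCoord_mul_pluckerCoord_eq_zero_of_add_eq hmin hij hlt
      hsum' hcdij)).resolve_left hne

theorem nullity_antidiagonalMap {K : Type*} [Field K] (hn : 1 ≤ n) (hm : 2 * n ≤ m + 3) :
    nullity (antidiagonalMap K n m) = 1 := by
  refine le_antisymm (Nat.le_of_lt_succ (not_le.1 fun h => ?_)) (one_le_nullity hn)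
  obtain ⟨x, y, hxy, hzero⟩ := two_le_nullity_iff.1 h
  exact antidiagonalMap_ιMulti_ne_zero hm hxy (DFunLike.congr_fun hzero ![])

end AntidiagonalMap

theorem mainTheorem8_general (K : Type*) [Field K] :
    (∀ [IsAlgClosed K] (n s : ℕ) (F : Type*) [AddCommGroup F] [Module K F] [Module.Finite K F],
      n.choose s * Module.finrank K F + 4 ≤ 2 * n →
        ∀ Ψ : (⋀[K]^(s + 2) (Fin n → K)) →ₗ[K] F, 2 ≤ nullity Ψ) ∧
    (∀ n m : ℕ, 1 ≤ n → 2 * n ≤ m + 3 →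
      ∃ Φ : (⋀[K]^2 (Fin n → K)) →ₗ[K] (Fin m → K), nullity Φ = 1) :=
  ⟨fun _ _ _ => two_le_nullity, fun _ _ hn hm => ⟨_, nullity_antidiagonalMap hn hm⟩⟩

theorem mainTheorem8 (K : Type*) [Field K] [IsAlgClosed K] :
    (∀ n m : ℕ, (m : ℤ) ≤ 2 * (n : ℤ) - 4 →
      ∀ Φ : (⋀[K]^2 (Fin n → K)) →ₗ[K] (Fin m → K), 2 ≤ nullity Φ) ∧
    (∀ n m : ℕ, 1 ≤ n → 2 * (n : ℤ) - 4 < (m : ℤ) →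
      ∃ Φ : (⋀[K]^2 (Fin n → K)) →ₗ[K] (Fin m → K), nullity Φ = 1) ∧
    (∀ n : ℕ, 4 ≤ n →
      ∀ Ψ : (⋀[K]^3 (Fin n → K)) →ₗ[K] K, 2 ≤ nullity Ψ) := by
  obtain ⟨h₁, h₂⟩ := mainTheorem8_general K
  refine ⟨fun n m h => h₁ n 0 _ ?_, fun n m hn h => h₂ n m hn (by omega), fun n h => h₁ n 1 _ ?_⟩
  · rw [Nat.choose_zero_right, Module.finrank_fin_fun]
    omega
  · rw [Nat.choose_one_right, Module.finrank_self]
    omega
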